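/- All graphs are finite and simple. A graph $G$ is critically $s$-chromatic if $\chi(G)=s$ and $\chi(G\setminus x)=s-1$ for every vertex $x$. For $W\subseteq V_G$, the expansion $G[W]$ is the graph obtained from $G$ by replacing each vertex $x\in W$ by two adjacent copies of $x$, each copy being joined to all the (copies of the) neighbours of $x$. For a field $k$ and $R=k[x_i : i\in V_G]$, the cover ideal of $G$ is $J(G)=\bigcap_{\{i,j\}\in E_G}(x_i,x_j)\subseteq R$. 1. A graph is critically $3$-chromatic if and only if it is an odd cycle $C_{2r+1}$ with $r\ge 1$. 2. Let $C$ be an odd cycle with consecutive vertices $x_1,\dots,x_{2r+1}$, $r\ge 1$, and let $W=\{x_2,x_4,\dots,x_{2r}\}$. Then $\chi(C[W])=4=\chi(C)+1$, and $C[W]$ is critically $4$-chromatic. Consequently, for every critically $3$-chromatic graph $G$ there is a subset $W\subseteq V_G$ such that $G[W]$ is critically $4$-chromatic. 3. For every graph $G$ with cover ideal $J=J(G)$, one has $\operatorname{Ass}(R/J^2)\subseteq\operatorname{Ass}(R/J^3)$. 4. For every graph $G$ with cover ideal $J=J(G)$, the set $\operatorname{Ass}(R/J^3)$ contains all the primes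 $(x_i,x_j)$ with $\{i,j\}\in E_G$ and all the primes $(x_i : i\in S)$ for which the induced subgraph of $G$ on $S\subseteq V_G$ is an odd cycle (of length at least $3$). -/

import Mathlib

universe u v

/-- `G` is critically `s`-chromatic: `χ(G) = s`, and `χ(G ∖ x) = s - 1` for every vertex `x`
(the latter is written without subtraction). -/
def SimpleGraph.IsCriticallyChromatic {V : Type u} (G : SimpleGraph V) (s : ℕ) : Prop :=
  G.chromaticNumber = (s : ℕ∞) ∧
    ∀ x : V, (G.induce ({x}ᶜ : Set V)).chromaticNumber + 1 = (s : ℕ∞)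

/-- The vertex of `G` of which a vertex of the expansion of `G` at `W` is a copy. -/
def SimpleGraph.expansionProj {V : Type u} (W : Set V) : V ⊕ W → V
  | Sum.inl x => x
  | Sum.inr w => (w : V)

/-- The expansion `G[W]`: every vertex `x ∈ W` is replaced by a clique `K₂` on two copies
`Sum.inl x`, `Sum.inr x` of `x`, while a vertex `x ∉ W` has the single copy `Sum.inl x`.
Two distinct vertices are adjacent if and only if they are copies of the same vertex of `G`
or of adjacent vertices of `G`. -/
def SimpleGraph.expansion {V : Type u} (G : SimpleGraph V) (W : Set V) : SimpleGraph (V ⊕ W) where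
  Adj a b :=
    G.Adj (SimpleGraph.expansionProj W a) (SimpleGraph.expansionProj W b) ∨
      (SimpleGraph.expansionProj W a = SimpleGraph.expansionProj W b ∧ a ≠ b)
  symm := ⟨fun _ _ h => h.elim (fun h => Or.inl h.symm) (fun h => Or.inr ⟨h.1.symm, h.2.symm⟩)⟩
  loopless := ⟨fun _ h => h.elim (fun h => G.irrefl h) (fun h => h.2 rfl)⟩

/-- `G` is an odd cycle `C_{2r+1}`, `r ≥ 1`. -/
def SimpleGraph.IsOddCycle {V : Type u} (G : SimpleGraph V) : Prop :=
  ∃ r : ℕ, 1 ≤ r ∧ Nonempty (G ≃g SimpleGraph.cycleGraph (2 * r + 1))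

/-- The cover ideal `J(G) = ⋂_{{i,j} ∈ E(G)} (x_i, x_j)` in the polynomial ring `k[x_i : i ∈ V]`. -/
noncomputable def SimpleGraph.coverIdeal {V : Type u} (G : SimpleGraph V) (k : Type v) [Field k] :
    Ideal (MvPolynomial V k) :=
  ⨅ (i : V) (j : V) (_ : G.Adj i j), Ideal.span {MvPolynomial.X i, MvPolynomial.X j}

/-! A monomial `x^a` lies in `J^s` iff it is divisible by a product of `s` vertex covers. Recording
at each vertex the covers that miss it gives a colouring problem, `HasColorSets`: adjacent vertices
get disjoint sets, and vertex `i` demands `s - a i` of `s` colours. A prime in `Ass(R/J^s)` is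
generated by the variables of a set `S` and annihilates some `x^a`: the demands are unsolvable,
raising `a` at any one vertex of `S` makes them solvable, raising `a` outside `S` never does.

For `s = 2` this forces `S` to be an edge or to induce a critically 3-chromatic graph, hence an odd
cycle, since a shortest odd closed walk is an induced cycle. For `s = 3`, demand two colours at
every second vertex of an odd cycle and one at the others. The one-colour vertices must then share a
colour, yet two of them are adjacent; lowering one demand removes the obstruction. This fact
(`not_exists_colorSets_cycleGraph`, `exists_colorSets_cycleGraph`) puts odd cycles in `Ass(R/J^3)`;
the same colourings make `C[W]` critically 4-chromatic. -/

namespace SimpleGraph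

/-! ### Critical graphs and vertex deletion -/

lemma colorable_induce_iff {V : Type u} (G : SimpleGraph V) (S : Set V) (n : ℕ) :
    (G.induce S).Colorable (n + 1) ↔
      ∃ c : V → Fin (n + 1), ∀ i ∈ S, ∀ j ∈ S, G.Adj i j → c i ≠ c j := by
  classical
  constructor
  · rintro ⟨c⟩
    refine ⟨fun i => if h : i ∈ S then c ⟨i, h⟩ else 0, fun i hi j hj hij => ?_⟩
    simp only [hi, hj, dif_pos]
    exact c.valid (by simpa using hij)
  · rintro ⟨c, hc⟩
    exact ⟨Coloring.mk (fun i => c i) fun {i j} hij => hc i i.2 j j.2 (by simpa using hij)⟩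

lemma Colorable.of_induce_compl_singleton {V : Type u} {G : SimpleGraph V} {x : V} {n : ℕ}
    (h : (G.induce ({x}ᶜ : Set V)).Colorable n) : G.Colorable (n + 1) := by
  classical
  obtain ⟨c⟩ := h
  refine ⟨Coloring.mk
    (fun i => if h : i = x then Fin.last n else (c ⟨i, h⟩).castSucc) fun {i j} hij => ?_⟩
  have hne := hij.ne
  by_cases hi : i = x <;> by_cases hj : j = x
  · exact absurd (hi.trans hj.symm) hne
  · simp [hi, hj, (Fin.castSucc_lt_last _).ne']
  · simp [hi, hj, (Fin.castSucc_lt_last _).ne]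
  · simp only [hi, hj, dif_neg, not_false_eq_true, ne_eq, Fin.castSucc_inj]
    exact c.valid (by simpa using hij)

/-- A graph is critically `(s + 1)`-chromatic iff it is not `s`-colorable, but becomes so upon
deletion of any vertex. -/
lemma isCriticallyChromatic_succ_iff {V : Type u} (G : SimpleGraph V) (s : ℕ) :
    G.IsCriticallyChromatic (s + 1) ↔
      ¬ G.Colorable s ∧ ∀ x : V, (G.induce ({x}ᶜ : Set V)).Colorable s := by
  constructor
  · rintro ⟨h₁, h₂⟩
    refine ⟨fun h => ?_, fun x => ?_⟩
    · have := h.chromaticNumber_le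
      rw [h₁] at this
      norm_cast at this
      omega
    · rw [← chromaticNumber_le_iff_colorable]
      have := h₂ x
      push_cast at this
      exact (WithTop.add_right_cancel ENat.one_ne_top this).le
  · rintro ⟨h₁, h₂⟩
    have hV : Nonempty V := by
      by_contra h
      rw [not_nonempty_iff] at h
      exact h₁ (Colorable.of_isEmpty s)
    refine ⟨chromaticNumber_eq_iff_colorable_not_colorable.2
      ⟨(h₂ hV.some).of_induce_compl_singleton, h₁⟩, fun x => ?_⟩
    have hle := (h₂ x).chromaticNumber_le
    have hge : (s : ℕ∞) ≤ (G.induce ({x}ᶜ : Set V)).chromaticNumber := by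
      by_contra! hlt
      obtain ⟨t, ht⟩ := ENat.ne_top_iff_exists.1 hlt.ne_top
      rw [← ht] at hlt
      have hts : t + 1 ≤ s := by exact_mod_cast hlt
      exact h₁ ((chromaticNumber_le_iff_colorable.1 ht.ge).of_induce_compl_singleton.mono hts)
    rw [le_antisymm hle hge]
    simp

lemma cycleGraph_adj_iff_val {n : ℕ} (hn : 3 ≤ n) {i j : Fin n} :
    (cycleGraph n).Adj i j ↔ (i : ℕ) + 1 = j ∨ (j : ℕ) + 1 = i ∨
      ((i : ℕ) = 0 ∧ (j : ℕ) + 1 = n) ∨ ((j : ℕ) = 0 ∧ (i : ℕ) + 1 = n) := by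
  rw [cycleGraph_adj']
  have hmod : ∀ x < 2 * n, x % n = if x < n then x else x - n := fun x hx => by
    split_ifs with h
    · exact Nat.mod_eq_of_lt h
    · rw [Nat.mod_eq_sub_mod (not_lt.1 h), Nat.mod_eq_of_lt (by omega)]
  rw [Fin.sub_def, Fin.sub_def]
  simp only
  rw [hmod _ (by omega), hmod _ (by omega)]
  split_ifs <;> omega

/-! ### Closed walks and critically 3-chromatic graphs -/

/-- `w 0, w 1, …, w n = w 0` is a closed walk in `G`. -/
def IsClosedWalk {V : Type u} (G : SimpleGraph V) (w : ℕ → V) (n : ℕ) : Prop :=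
  (∀ i < n, G.Adj (w i) (w (i + 1))) ∧ w n = w 0

namespace IsClosedWalk
variable {V : Type u} {G : SimpleGraph V} {w : ℕ → V} {n : ℕ}

/-- With `skip`, this splits a walk at a repeated vertex; the two lengths sum to `n`, so one is odd
if `n` is. -/
lemma segment (h : G.IsClosedWalk w n) {a b : ℕ} (hab : a ≤ b) (hb : b ≤ n) (hw : w a = w b) :
    G.IsClosedWalk (fun i => w (a + i)) (b - a) := by
  refine ⟨fun i hi => h.1 (a + i) (by omega), ?_⟩
  simp [Nat.add_sub_cancel' hab, hw]

lemma skip (h : G.IsClosedWalk w n) {a b : ℕ} (hab : a ≤ b) (hb : b ≤ n) (hw : w a = w b) :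
    G.IsClosedWalk (fun i => if i ≤ a then w i else w (i + (b - a))) (n - (b - a)) := by
  refine ⟨fun i hi => ?_, ?_⟩
  · rcases lt_trichotomy i a with hia | rfl | hia
    · simpa [hia.le, Nat.succ_le_of_lt hia] using h.1 i (by omega)
    · have := h.1 b (by omega)
      rw [← hw] at this
      simpa [show i + 1 + (b - i) = b + 1 by omega] using this
    · simpa [hia.not_ge, (Nat.lt_succ_of_lt hia).not_ge, Nat.add_right_comm] using
        h.1 (i + (b - a)) (by omega)
  · by_cases hna : n - (b - a) ≤ a
    · have hbn : b = n := by omega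
      have : n - (b - a) = a := by omega
      simp only
      rw [if_pos hna, if_pos (Nat.zero_le a), this, hw, hbn, h.2]
    · simp [hna, show n - (b - a) + (b - a) = n by omega, h.2]

/-- With `skip_of_adj`, this splits a walk along a chord; the lengths sum to `n + 2`, so again one
is odd if `n` is. -/
lemma segment_of_adj (h : G.IsClosedWalk w n) {a b : ℕ} (hab : a ≤ b) (hb : b ≤ n)
    (hw : G.Adj (w a) (w b)) :
    G.IsClosedWalk (fun i => if i ≤ b - a then w (a + i) else w a) (b - a + 1) := by
  refine ⟨fun i hi => ?_, by simp⟩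
  rcases (Nat.lt_succ_iff.1 hi).lt_or_eq with hi | rfl
  · simpa [hi.le, Nat.succ_le_of_lt hi] using! h.1 (a + i) (by omega)
  · simpa [Nat.add_sub_cancel' hab] using hw.symm

lemma skip_of_adj (h : G.IsClosedWalk w n) {a b : ℕ} (hab : a < b) (hb : b ≤ n)
    (hw : G.Adj (w a) (w b)) :
    G.IsClosedWalk (fun i => if i ≤ a then w i else w (i + (b - a - 1))) (n - (b - a) + 1) := by
  refine ⟨fun i hi => ?_, ?_⟩
  · rcases lt_trichotomy i a with hia | rfl | hia
    · simpa [hia.le, Nat.succ_le_of_lt hia] using h.1 i (by omega)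
    · simpa [show i + 1 + (b - i - 1) = b by omega] using hw
    · simpa [hia.not_ge, (Nat.lt_succ_of_lt hia).not_ge, Nat.add_right_comm] using
        h.1 (i + (b - a - 1)) (by omega)
  · simp [show ¬ n - (b - a) + 1 ≤ a by omega,
      show n - (b - a) + 1 + (b - a - 1) = n by omega, h.2]

lemma ne_one (h : G.IsClosedWalk w n) : n ≠ 1 := by
  rintro rfl
  have := h.1 0 one_pos
  rw [zero_add, h.2] at this
  exact G.irrefl this

end IsClosedWalk

lemma exists_isClosedWalk_odd {V : Type u} {G : SimpleGraph V} (h : ¬ G.Colorable 2) :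
    ∃ n w, Odd n ∧ G.IsClosedWalk w n := by
  rw [two_colorable_iff_forall_loop_even] at h
  push Not at h
  obtain ⟨u, p, hp⟩ := h
  exact ⟨p.length, p.getVert, by simpa using hp, fun i hi => p.adj_getVert_succ hi, by simp⟩

/-- A shortest odd closed walk is an induced cycle. -/
lemma exists_cycleGraph_embedding {V : Type u} {G : SimpleGraph V} (h : ¬ G.Colorable 2) :
    ∃ r, 1 ≤ r ∧ Nonempty (cycleGraph (2 * r + 1) ↪g G) := by
  classical
  have hex := exists_isClosedWalk_odd h
  obtain ⟨w, hodd, hw⟩ := Nat.find_spec hex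
  have hmin : ∀ m w, Odd m → G.IsClosedWalk w m → Nat.find hex ≤ m :=
    fun m w h₁ h₂ => Nat.find_min' hex ⟨w, h₁, h₂⟩
  generalize Nat.find hex = n at *
  obtain ⟨r, rfl⟩ := hodd
  have h1 := hw.ne_one
  refine ⟨r, by omega, ?_⟩
  have hne : ∀ a b, a < b → b < 2 * r + 1 → w a ≠ w b := by
    intro a b hab hb hwab
    rcases Nat.even_or_odd (b - a) with he | ho
    · have := hmin _ _ ?_ (hw.skip hab.le hb.le hwab)
      · omega
      · grind
    · have := hmin _ _ ho (hw.segment hab.le hb.le hwab)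
      omega
  have hadj : ∀ a b, a < b → b < 2 * r + 1 → G.Adj (w a) (w b) →
      a + 1 = b ∨ (a = 0 ∧ b + 1 = 2 * r + 1) := by
    intro a b hab hb hwab
    rcases Nat.even_or_odd (b - a) with he | ho
    · have := hmin _ _ he.add_one (hw.segment_of_adj hab.le hb.le hwab)
      omega
    · have := hmin _ _ ?_ (hw.skip_of_adj hab hb.le hwab)
      · omega
      · grind
  have hlast : G.Adj (w 0) (w (2 * r)) := by
    have := hw.1 (2 * r) (by omega)
    rw [hw.2] at this
    exact this.symm
  refine ⟨⟨⟨fun i : Fin (2 * r + 1) => w i, fun i j hij => ?_⟩, fun {i j} => ?_⟩⟩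
  · rcases lt_trichotomy i j with hlt | heq | hlt
    · exact absurd hij (hne i j hlt j.2)
    · exact heq
    · exact absurd hij.symm (hne j i hlt i.2)
  · rw [cycleGraph_adj_iff_val (by omega)]
    change G.Adj (w i) (w j) ↔ _
    constructor
    · intro hij
      rcases lt_trichotomy i j with hlt | heq | hlt
      · have := hadj i j hlt j.2 hij
        omega
      · exact absurd (heq ▸ hij) G.irrefl
      · have := hadj j i hlt i.2 hij.symm
        omega
    · rintro (hij | hij | ⟨hi, hj⟩ | ⟨hi, hj⟩)
      · exact hij ▸ hw.1 i (by omega)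
      · exact (hij ▸ hw.1 j (by omega)).symm
      · rw [hi, show (j : ℕ) = 2 * r by omega]; exact hlast
      · rw [hi, show (i : ℕ) = 2 * r by omega]; exact hlast.symm

lemma not_colorable_two_cycleGraph {r : ℕ} (hr : 1 ≤ r) :
    ¬ (cycleGraph (2 * r + 1)).Colorable 2 := by
  rw [← chromaticNumber_le_iff_colorable,
    chromaticNumber_cycleGraph_of_odd _ (by omega) ⟨r, rfl⟩]
  decide

/-- An induced odd cycle missing a vertex `x` would survive in the 2-colourable graph `G ∖ x`. -/
lemma IsCriticallyChromatic.isOddCycle {V : Type u} {G : SimpleGraph V}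
    (h : G.IsCriticallyChromatic 3) : G.IsOddCycle := by
  obtain ⟨h₁, h₂⟩ := (isCriticallyChromatic_succ_iff G 2).1 h
  obtain ⟨r, hr, ⟨f⟩⟩ := exists_cycleGraph_embedding h₁
  refine ⟨r, hr, ⟨(RelIso.ofSurjective f fun x => ?_).symm⟩⟩
  by_contra! hx
  refine not_colorable_two_cycleGraph hr ((h₂ x).of_hom ⟨fun i => ⟨f i, hx i⟩, fun {i j} hij => ?_⟩)
  simpa using hij

lemma isCriticallyChromatic_cycleGraph {r : ℕ} (hr : 1 ≤ r) :
    (cycleGraph (2 * r + 1)).IsCriticallyChromatic 3 := by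
  refine (isCriticallyChromatic_succ_iff _ 2).2 ⟨not_colorable_two_cycleGraph hr, fun x => ?_⟩
  rw [colorable_induce_iff _ _ 1]
  -- Colour by parity and flip past `x`, so that the closing edge `{0, 2r}` of even ends is proper.
  refine ⟨fun i => if (Even (i : ℕ) ↔ i < x) then 0 else 1, fun i hi j hj hij => ?_⟩
  rw [cycleGraph_adj_iff_val (by omega)] at hij
  simp only [Set.mem_compl_iff, Set.mem_singleton_iff] at hi hj
  grind

lemma IsCriticallyChromatic.of_iso {V : Type u} {V' : Type v} {G : SimpleGraph V}
    {G' : SimpleGraph V'} {s : ℕ} (e : G ≃g G') (h : G'.IsCriticallyChromatic (s + 1)) :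
    G.IsCriticallyChromatic (s + 1) := by
  rw [isCriticallyChromatic_succ_iff] at h ⊢
  refine ⟨fun hc => h.1 (hc.of_hom e.symm.toHom), fun x => (h.2 (e x)).of_hom
    ⟨fun i => ⟨e i, fun hi => i.2 (e.injective hi)⟩, fun {i j} hij => ?_⟩⟩
  simpa using e.map_rel_iff.2 hij

lemma isCriticallyChromatic_three_iff {V : Type u} (G : SimpleGraph V) :
    G.IsCriticallyChromatic 3 ↔ G.IsOddCycle :=
  ⟨IsCriticallyChromatic.isOddCycle, fun ⟨_, hr, ⟨e⟩⟩ =>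
    IsCriticallyChromatic.of_iso e (isCriticallyChromatic_cycleGraph hr)⟩

end SimpleGraph

/-! ### Expansions of odd cycles -/

namespace SimpleGraph

/-- In a system of pairwise disjoint colour sets along an odd cycle, with three colours in total,
the odd positions cannot all receive two colours while the even ones receive at least one. -/
lemma not_exists_colorSets_cycleGraph {r : ℕ} (hr : 1 ≤ r) (c : Fin (2 * r + 1) → Finset (Fin 3))
    (hc : ∀ i j, (cycleGraph (2 * r + 1)).Adj i j → Disjoint (c i) (c j))
    (hodd : ∀ i : Fin (2 * r + 1), Odd (i : ℕ) → 2 ≤ (c i).card) (heven : ∀ i, (c i).Nonempty) : False := by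
  -- Two colours in `A` leave only one for both its neighbours `B` and `D`, so `t` passes from
  -- position `0` through the even positions to `2r`.
  have step : ∀ t : Fin 3, ∀ A B D : Finset (Fin 3), 2 ≤ A.card → Disjoint B A → Disjoint A D →
      t ∈ B → D.Nonempty → t ∈ D := by
    decide
  obtain ⟨t, ht⟩ := heven 0
  have key : ∀ k, ∀ hk : 2 * k < 2 * r + 1, t ∈ c ⟨2 * k, hk⟩ := by
    intro k
    induction k with
    | zero => exact fun _ => ht
    | succ k ih =>
      intro hk
      exact step t (c ⟨2 * k + 1, by omega⟩) (c ⟨2 * k, by omega⟩) _ (hodd _ ⟨k, rfl⟩)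
        (hc _ _ ((cycleGraph_adj_iff_val (by omega)).2 (Or.inl rfl)))
        (hc _ _ ((cycleGraph_adj_iff_val (by omega)).2 (Or.inl rfl))) (ih _) (heven _)
  refine Finset.disjoint_left.1 (hc 0 ⟨2 * r, by omega⟩ ?_) ht (key r (by omega))
  rw [cycleGraph_adj_iff_val (by omega)]
  simp

/-- A colouring would give each vertex the set of colours of its copies, two at odd positions. -/
lemma not_colorable_three_expansion_cycleGraph {r : ℕ} (hr : 1 ≤ r) :
    ¬ ((cycleGraph (2 * r + 1)).expansion {i : Fin (2 * r + 1) | Odd (i : ℕ)}).Colorable 3 := by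
  classical
  rintro ⟨f⟩
  refine not_exists_colorSets_cycleGraph hr
    (fun i => Finset.univ.filter fun t => ∃ a, expansionProj _ a = i ∧ f a = t) ?_ ?_ ?_
  · intro i j hij
    rw [Finset.disjoint_left]
    simp only [Finset.mem_filter_univ]
    rintro _ ⟨a, rfl, rfl⟩ ⟨b, rfl, hb⟩
    exact f.valid (Or.inl hij) hb.symm
  · intro i (hi : Odd (i : ℕ))
    refine Nat.succ_le_of_lt (Finset.one_lt_card.2
      ⟨f (Sum.inl i), ?_, f (Sum.inr ⟨i, hi⟩), ?_, ?_⟩)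
    · exact Finset.mem_filter.2 ⟨Finset.mem_univ _, Sum.inl i, rfl, rfl⟩
    · exact Finset.mem_filter.2 ⟨Finset.mem_univ _, Sum.inr ⟨i, hi⟩, rfl, rfl⟩
    · exact f.valid (Or.inr ⟨rfl, by simp⟩)
  · exact fun i => ⟨f (Sum.inl i),
      Finset.mem_filter.2 ⟨Finset.mem_univ _, Sum.inl i, rfl, rfl⟩⟩

lemma isCriticallyChromatic_expansion_cycleGraph {r : ℕ} (hr : 1 ≤ r) :
    ((cycleGraph (2 * r + 1)).expansion
      {i : Fin (2 * r + 1) | Odd (i : ℕ)}).IsCriticallyChromatic 4 := by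
  refine (isCriticallyChromatic_succ_iff _ 3).2
    ⟨not_colorable_three_expansion_cycleGraph hr, fun y => ?_⟩
  rw [colorable_induce_iff _ _ 2]
  -- Even positions change from 0 to 1 at `y`; odd ones use 1 and 2 before it, 0 and 2 after it, and
  -- a surviving copy at `y` uses 2.
  refine ⟨Sum.elim (fun i => if Even (i : ℕ) then (if i < expansionProj _ y then 0 else 1)
    else if i < expansionProj _ y then 1 else if expansionProj _ y < i then 0 else 2) fun _ => 2, ?_⟩
  rintro (i | ⟨i, hi⟩) hiy (j | ⟨j, hj⟩) hjy hij <;>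
  rcases y with y | ⟨y, hy⟩ <;>
  simp only [expansion, cycleGraph_adj_iff_val (show 3 ≤ 2 * r + 1 by omega), expansionProj,
    Set.mem_compl_iff, Set.mem_singleton_iff, Sum.inl.injEq, Sum.inr.injEq, Sum.elim_inl,
    Sum.elim_inr, Subtype.mk.injEq, ne_eq, reduceCtorEq, not_false_eq_true, and_true] at *
  all_goals grind

/-- The expansions of isomorphic graphs at corresponding vertex sets are isomorphic. -/
def Iso.expansion {V : Type u} {V' : Type v} {G : SimpleGraph V} {G' : SimpleGraph V'}
    (e : G ≃g G') (W : Set V') : G.expansion (e ⁻¹' W) ≃g G'.expansion W where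
  toEquiv := e.toEquiv.sumCongr (e.toEquiv.subtypeEquiv fun _ => Iff.rfl)
  map_rel_iff' {a b} := by
    rcases a with a | a <;> rcases b with b | b <;>
      simp [SimpleGraph.expansion, expansionProj, Subtype.ext_iff, ← e.map_adj_iff]

lemma IsOddCycle.exists_isCriticallyChromatic_expansion {V : Type u} {G : SimpleGraph V}
    (h : G.IsOddCycle) : ∃ W : Set V, (G.expansion W).IsCriticallyChromatic 4 := by
  obtain ⟨r, hr, ⟨e⟩⟩ := h
  exact ⟨_, (isCriticallyChromatic_expansion_cycleGraph hr).of_iso (e.expansion _)⟩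

/-- Lowering the demand of the colour sets in `not_exists_colorSets_cycleGraph` by one at a
single vertex makes it satisfiable. -/
lemma exists_colorSets_cycleGraph {r : ℕ} (hr : 1 ≤ r) (x : Fin (2 * r + 1)) :
    ∃ c : Fin (2 * r + 1) → Finset (Fin 3),
      (∀ i j, (cycleGraph (2 * r + 1)).Adj i j → Disjoint (c i) (c j)) ∧
      ∀ i : Fin (2 * r + 1), (if Odd (i : ℕ) then 2 else 1) ≤ (c i).card + if i = x then 1 else 0 := by
  refine ⟨fun i => if Odd (i : ℕ) then (if i < x then {1, 2} else if x < i then {0, 2} else {2})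
    else if i < x then {0} else if x < i then {1} else ∅, fun i j hij => ?_, fun i => ?_⟩
  · rw [cycleGraph_adj_iff_val (by omega)] at hij
    simp only
    split_ifs <;> first | decide | grind
  · simp only
    split_ifs <;> first | decide | grind

end SimpleGraph

/-! ### Associated primes of monomial ideals -/

namespace MvPolynomial

variable {σ : Type u} {k : Type v} [Field k]

/-- The ideal is the kernel of the substitution killing the variables of `S`, whose target is a
domain. -/
lemma isPrime_span_X_image (S : Set σ) :
    (Ideal.span (X '' S : Set (MvPolynomial σ k))).IsPrime := by
  classical
  set φ : MvPolynomial σ k →ₐ[k] MvPolynomial σ k := aeval fun i => if i ∈ S then 0 else X i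
    with hφ
  have hker : Ideal.span (X '' S : Set (MvPolynomial σ k)) = RingHom.ker φ := by
    apply le_antisymm
    · rw [Ideal.span_le]
      rintro _ ⟨i, hi, rfl⟩
      simp [hφ, hi]
    · have hcomp : (Ideal.Quotient.mkₐ k (Ideal.span (X '' S))).comp φ =
          Ideal.Quotient.mkₐ k (Ideal.span (X '' S : Set (MvPolynomial σ k))) := by
        ext i
        by_cases hi : i ∈ S
        · have hX : (X i : MvPolynomial σ k) ∈ Ideal.span (X '' S) :=
            Ideal.subset_span ⟨i, hi, rfl⟩
          simp [hφ, hi, Ideal.Quotient.eq_zero_iff_mem.2 hX]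
        · simp [hφ, hi]
      intro f hf
      have := DFunLike.congr_fun hcomp f
      rw [AlgHom.comp_apply, (RingHom.mem_ker).1 hf, map_zero] at this
      exact Ideal.Quotient.eq_zero_iff_mem.1 this.symm
  rw [hker]
  exact RingHom.ker_isPrime _

lemma card_support_sub_monomial_lt {f : MvPolynomial σ k} {d : σ →₀ ℕ} (hd : d ∈ f.support) :
    (f - monomial d (f.coeff d)).support.card < f.support.card := by
  classical
  refine (Finset.card_le_card (t := f.support.erase d) fun m hm => ?_).trans_lt
    (Finset.card_erase_lt_of_mem hd)
  rw [mem_support_iff, coeff_sub, coeff_monomial] at hm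
  rw [Finset.mem_erase, mem_support_iff]
  split_ifs at hm with h
  · subst h; simp at hm
  · exact ⟨Ne.symm h, by simpa using hm⟩

/-- `I` is the monomial ideal of the polynomials all of whose exponents lie in `U`. -/
def IsMonomialIdeal (I : Ideal (MvPolynomial σ k)) (U : Set (σ →₀ ℕ)) : Prop :=
  ∀ f, f ∈ I ↔ ∀ m ∈ f.support, m ∈ U

namespace IsMonomialIdeal
variable {I : Ideal (MvPolynomial σ k)} {U : Set (σ →₀ ℕ)}

lemma monomial_mem_iff (hI : IsMonomialIdeal I U) {a : σ →₀ ℕ} {c : k} (hc : c ≠ 0) :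
    monomial a c ∈ I ↔ a ∈ U := by
  classical
  rw [hI, support_monomial, if_neg hc]
  simp

lemma mul_monomial_mem_iff (hI : IsMonomialIdeal I U) {f : MvPolynomial σ k} {a : σ →₀ ℕ} {c : k}
    (hc : c ≠ 0) : f * monomial a c ∈ I ↔ ∀ m ∈ f.support, m + a ∈ U := by
  rw [hI]
  constructor
  · intro h m hm
    refine h _ ?_
    rw [mem_support_iff, coeff_mul_monomial]
    exact mul_ne_zero (mem_support_iff.1 hm) hc
  · intro h m hm
    rw [mem_support_iff, coeff_mul_monomial'] at hm
    split_ifs at hm with ham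
    · have := h (m - a) (mem_support_iff.2 (left_ne_zero_of_mul hm))
      rwa [tsub_add_cancel_of_le ham] at this
    · exact absurd rfl hm

lemma add_mem (hI : IsMonomialIdeal I U) {a b : σ →₀ ℕ} (ha : a ∈ U) : b + a ∈ U := by
  have := I.mul_mem_left (monomial b 1) ((hI.monomial_mem_iff (one_ne_zero (α := k))).2 ha)
  rw [monomial_mul, hI.monomial_mem_iff (by simp)] at this
  exact this

/-- The prime is the annihilator of `x^a`, as membership in `I` is tested term by term. -/
lemma span_X_image_mem_associatedPrimes (hI : IsMonomialIdeal I U) {S : Set σ} {a : σ →₀ ℕ}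
    (h₁ : ∀ i ∈ S, Finsupp.single i 1 + a ∈ U)
    (h₂ : ∀ m : σ →₀ ℕ, (∀ i ∈ S, m i = 0) → m + a ∉ U) :
    Ideal.span ((fun i : σ => (X i : MvPolynomial σ k)) '' S) ∈
      associatedPrimes (MvPolynomial σ k) (MvPolynomial σ k ⧸ I) := by
  have hP := isPrime_span_X_image (k := k) S
  refine ⟨hP, Ideal.Quotient.mk I (monomial a 1), ?_⟩
  suffices h : Ideal.span ((fun i : σ => (X i : MvPolynomial σ k)) '' S) =
      Submodule.colon ⊥ {Ideal.Quotient.mk I (monomial a 1)} by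
    rw [← h]; exact hP.radical.symm
  ext f
  rw [Submodule.mem_colon_singleton, Submodule.mem_bot, ← Ideal.Quotient.mk_eq_mk,
    ← Submodule.Quotient.mk_smul, smul_eq_mul, Submodule.Quotient.mk_eq_zero,
    hI.mul_monomial_mem_iff one_ne_zero]
  refine (mem_ideal_span_X_image (σ := σ) (R := k)).trans
    (forall₂_congr fun m _ => ⟨?_, fun h => ?_⟩)
  · rintro ⟨i, hi, hm⟩
    have hle : Finsupp.single i 1 ≤ m := by
      rw [Finsupp.single_le_iff]
      omega
    have := hI.add_mem (b := m - Finsupp.single i 1) (h₁ i hi)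
    rwa [← add_assoc, tsub_add_cancel_of_le hle] at this
  · by_contra! hm
    exact h₂ m hm h

/-- If `g * f` lies in a monomial ideal, then so does `f` times a power of the leading monomial
of `g`. -/
lemma leadingMonomial_pow_mul_mem (hI : IsMonomialIdeal I U) (o : MonomialOrder σ)
    {g : MvPolynomial σ k} (hg : g ≠ 0) (n : ℕ) :
    ∀ f : MvPolynomial σ k, f.support.card ≤ n → f * g ∈ I →
      f * monomial (o.degree g) 1 ^ n ∈ I := by
  classical
  induction n with
  | zero =>
    intro f hf _
    have : f = 0 := by simpa using hf
    simp [this]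
  | succ n ih =>
    intro f hf hfg
    by_cases hf0 : f = 0
    · simp [hf0]
    set t := monomial (o.degree f) (f.coeff (o.degree f)) with ht
    have hlead : t * monomial (o.degree g) 1 ∈ I := by
      have hdeg : o.degree f + o.degree g ∈ U := by
        refine (hI _).1 hfg _ ?_
        rw [← o.degree_mul hf0 hg]
        exact o.degree_mem_support (mul_ne_zero hf0 hg)
      rw [ht, monomial_mul, hI.monomial_mem_iff]
      · exact hdeg
      · simpa [o.coeff_degree_eq_zero_iff] using hf0
    have hcard : ((f - t) * monomial (o.degree g) 1).support.card ≤ n := by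
      have h1 : ((f - t) * monomial (o.degree g) 1).support.card ≤ (f - t).support.card := by
        refine (Finset.card_le_card (support_mul _ _)).trans ?_
        refine Finset.card_add_le.trans ?_
        calc _ ≤ (f - t).support.card * 1 := by
              gcongr
              exact (Finset.card_le_card support_monomial_subset).trans (by simp)
          _ = _ := mul_one _
      have h2 := card_support_sub_monomial_lt (o.degree_mem_support hf0)
      rw [← ht] at h2
      omega
    -- As `t` times the leading monomial of `g` is in `I`, dropping `t` keeps the product with `g`
    -- in `I`, with fewer terms.
    have := ih ((f - t) * monomial (o.degree g) 1) hcard (by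
      have h3 := I.sub_mem (I.mul_mem_left (monomial (o.degree g) 1) hfg) (I.mul_mem_left g hlead)
      convert h3 using 1
      ring)
    have h4 := I.add_mem this (I.mul_mem_left (monomial (o.degree g) 1 ^ n) hlead)
    convert h4 using 1
    ring

/-- The associated primes of a monomial ideal are generated by variables and are annihilators of
monomials. -/
lemma exists_of_mem_associatedPrimes [Finite σ] (hI : IsMonomialIdeal I U)
    {P : Ideal (MvPolynomial σ k)}
    (hP : P ∈ associatedPrimes (MvPolynomial σ k) (MvPolynomial σ k ⧸ I)) :
    ∃ (S : Set σ) (a : σ →₀ ℕ), P = Ideal.span ((fun i : σ => (X i : MvPolynomial σ k)) '' S) ∧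
      (∀ i ∈ S, Finsupp.single i 1 + a ∈ U) ∧
      ∀ m : σ →₀ ℕ, (∀ i ∈ S, m i = 0) → m + a ∉ U := by
  classical
  obtain ⟨hprime, x, hx⟩ := isAssociatedPrime_iff.1 hP
  obtain ⟨f, rfl⟩ := Ideal.Quotient.mk_surjective x
  have hmem : ∀ g, g ∈ P ↔ f * g ∈ I := fun g => by
    rw [hx, Submodule.mem_colon_singleton, Submodule.mem_bot, ← Ideal.Quotient.mk_eq_mk,
      ← Submodule.Quotient.mk_smul, smul_eq_mul, Submodule.Quotient.mk_eq_zero, mul_comm]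
  let e := Finite.equivFin σ
  let _ : LinearOrder σ := LinearOrder.lift' e e.injective
  let o : MonomialOrder σ := MonomialOrder.lex
  have hlead : ∀ g ∈ P, g ≠ 0 → monomial (o.degree g) 1 ∈ P := fun g hg hg0 =>
    hprime.mem_of_pow_mem _ ((hmem _).2
      (hI.leadingMonomial_pow_mul_mem o hg0 _ f le_rfl ((hmem g).1 hg)))
  have hvar : ∀ m : σ →₀ ℕ, monomial m (1 : k) ∈ P → ∃ i, X i ∈ P ∧ m i ≠ 0 := by
    intro m hm
    rw [monomial_eq, C_1, one_mul, Finsupp.prod, hprime.prod_mem_iff] at hm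
    obtain ⟨i, hi, hm⟩ := hm
    exact ⟨i, hprime.mem_of_pow_mem _ hm, by simpa using hi⟩
  have hterms : ∀ n, ∀ g ∈ P, g.support.card ≤ n → g ∈ Ideal.span (X '' {i | X i ∈ P}) := by
    intro n
    induction n with
    | zero =>
      intro g _ hg
      have : g = 0 := by simpa using hg
      simp [this]
    | succ n ih =>
      intro g hg hn
      by_cases hg0 : g = 0
      · simp [hg0]
      set t := monomial (o.degree g) (g.coeff (o.degree g)) with ht
      have ht' : t = C (g.coeff (o.degree g)) * monomial (o.degree g) 1 := by
        rw [ht, C_mul_monomial, mul_one]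
      have htP : t ∈ P := ht' ▸ P.mul_mem_left _ (hlead g hg hg0)
      have htspan : t ∈ Ideal.span (X '' {i | X i ∈ P} : Set (MvPolynomial σ k)) := by
        rw [mem_ideal_span_X_image]
        intro m hm
        rw [Finset.mem_singleton.1 (support_monomial_subset hm)]
        exact hvar _ (hlead g hg hg0)
      have h2 := card_support_sub_monomial_lt (o.degree_mem_support hg0)
      rw [← ht] at h2
      have := Ideal.add_mem _ (ih (g - t) (P.sub_mem hg htP) (by omega)) htspan
      rwa [sub_add_cancel] at this
  have hPS : P = Ideal.span ((fun i : σ => (X i : MvPolynomial σ k)) '' {i | X i ∈ P}) := by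
    apply le_antisymm (fun g hg => hterms _ g hg le_rfl)
    rw [Ideal.span_le]
    rintro _ ⟨i, hi, rfl⟩
    exact hi
  -- Otherwise each term of `f` has a multiplier into `I` free of the variables in `P`; their
  -- product kills `f`, so lies in `P`, a contradiction.
  have hex : ∃ a ∈ f.support, ∀ m : σ →₀ ℕ, (∀ i, X i ∈ P → m i = 0) → m + a ∉ U := by
    by_contra! hcon
    choose! m hm₁ hm₂ using hcon
    have hprod : monomial (∑ a ∈ f.support, m a) (1 : k) ∈ P := by
      rw [hmem, hI.mul_monomial_mem_iff one_ne_zero]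
      intro a ha
      rw [← Finset.sum_erase_add _ _ ha, add_comm, add_assoc]
      exact hI.add_mem (hm₂ a ha)
    obtain ⟨i, hi, hne⟩ := hvar _ hprod
    rw [Finsupp.finsetSum_apply] at hne
    exact hne (Finset.sum_eq_zero fun a ha => hm₁ a ha i hi)
  obtain ⟨a, ha, hm⟩ := hex
  refine ⟨{i | X i ∈ P}, a, hPS, fun i hi => ?_, hm⟩
  have := (hI.mul_monomial_mem_iff one_ne_zero).1 ((hmem (X i)).1 hi) a ha
  rwa [add_comm] at this

end IsMonomialIdeal
end MvPolynomial

/-! ### Powers of the cover ideal as colouring problems -/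

namespace SimpleGraph
open MvPolynomial

variable {V : Type u}

/-- Each vertex `i` of `G` can be given at least `s - a i` of `s` colours such that adjacent
vertices receive disjoint sets of colours. -/
def HasColorSets (G : SimpleGraph V) (s : ℕ) (a : V → ℕ) : Prop :=
  ∃ c : V → Finset (Fin s), (∀ i j, G.Adj i j → Disjoint (c i) (c j)) ∧ ∀ i, s ≤ a i + (c i).card

lemma HasColorSets.mono {G : SimpleGraph V} {s : ℕ} {a b : V → ℕ} (h : G.HasColorSets s a)
    (hab : ∀ i, a i ≤ b i) : G.HasColorSets s b := by
  obtain ⟨c, hc, hs⟩ := h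
  exact ⟨c, hc, fun i => (hs i).trans (by have := hab i; omega)⟩

lemma HasColorSets.le_add_of_adj {G : SimpleGraph V} {s : ℕ} {a : V → ℕ} (h : G.HasColorSets s a)
    {i j : V} (hij : G.Adj i j) : s ≤ a i + a j := by
  classical
  obtain ⟨c, hc, hs⟩ := h
  have h1 := Finset.card_union_of_disjoint (hc i j hij)
  have h2 := Finset.card_le_univ (c i ∪ c j)
  rw [Fintype.card_fin] at h2
  have h3 := hs i
  have h4 := hs j
  omega

/-- Vertices with `a i = 0` take both colours and those with `a i ≥ 2` none, so only `a i = 1`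
leaves a choice. -/
lemma hasColorSets_two_iff {G : SimpleGraph V} {a : V → ℕ} :
    G.HasColorSets 2 a ↔
      (∀ i j, G.Adj i j → 2 ≤ a i + a j) ∧ (G.induce {i | a i = 1}).Colorable 2 := by
  classical
  rw [colorable_induce_iff _ _ 1]
  constructor
  · intro h
    refine ⟨fun i j hij => h.le_add_of_adj hij, ?_⟩
    obtain ⟨c, hc, hs⟩ := h
    have hne : ∀ i ∈ {i | a i = 1}, ∃ t, t ∈ c i := fun i (hi : a i = 1) => by
      have := hs i
      exact Finset.card_pos.1 (by omega)
    choose! f hf using hne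
    exact ⟨f, fun i hi j hj hij hfij =>
      Finset.disjoint_left.1 (hc i j hij) (hf i hi) (hfij ▸ hf j hj)⟩
  · rintro ⟨h, f, hf⟩
    refine ⟨fun i => if a i = 0 then Finset.univ else if a i = 1 then {f i} else ∅,
      fun i j hij => ?_, fun i => ?_⟩
    · have h1 := h i j hij
      have h2 := fun hi hj => hf i hi j hj hij
      simp only [Set.mem_ofPred_eq] at h2
      simp only
      split_ifs <;> first | omega | simp_all
    · simp only
      split_ifs <;> simp <;> omega

/-- The exponents of the monomials of the cover ideal. -/
lemma coverIdeal_eq_span (G : SimpleGraph V) (k : Type v) [Field k] :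
    G.coverIdeal k = Ideal.span ((fun m => monomial m (1 : k)) ''
      {m : V →₀ ℕ | ∀ i j, G.Adj i j → m i ≠ 0 ∨ m j ≠ 0}) := by
  ext f
  simp only [coverIdeal, Ideal.mem_iInf]
  rw [mem_ideal_span_monomial_image]
  have hpair : ∀ i j : V, f ∈ Ideal.span {X i, X j} ↔ ∀ m ∈ f.support, m i ≠ 0 ∨ m j ≠ 0 := by
    intro i j
    rw [← Set.image_pair, mem_ideal_span_X_image]
    simp
  simp only [hpair]
  constructor
  · exact fun h m hm => ⟨m, fun i j hij => h i j hij m hm, le_rfl⟩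
  · intro h i j hij m hm
    obtain ⟨m', hm', hle⟩ := h m hm
    have h1 := hm' i j hij
    have h2 := hle i
    have h3 := hle j
    omega

lemma coverIdeal_pow_eq_span (G : SimpleGraph V) (k : Type v) [Field k] (s : ℕ) :
    G.coverIdeal k ^ s = Ideal.span ((fun m => monomial m (1 : k)) ''
      {m : V →₀ ℕ | ∃ d : Fin s → V →₀ ℕ,
        (∀ t i j, G.Adj i j → d t i ≠ 0 ∨ d t j ≠ 0) ∧ m = ∑ t, d t}) := by
  induction s with
  | zero =>
    simp only [pow_zero, IsEmpty.forall_iff, Finset.univ_eq_empty, Finset.sum_empty, true_and,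
      exists_const, Set.ofPred_eq_eq_singleton, Set.image_singleton]
    rw [Ideal.one_eq_top, ← C_apply, C_1, Ideal.span_singleton_one]
  | succ s ih =>
    rw [pow_succ, ih, coverIdeal_eq_span, Ideal.span_mul_span']
    congr 1
    ext f
    constructor
    · rintro ⟨_, ⟨_, ⟨d, hd, rfl⟩, rfl⟩, _, ⟨m, hm, rfl⟩, rfl⟩
      refine ⟨m + ∑ t, d t, ⟨Fin.cons m d, fun t => ?_, by simp [Fin.sum_univ_succ]⟩, ?_⟩
      · refine Fin.cases ?_ (fun t => ?_) t
        · simpa using hm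
        · simpa using hd t
      · simp [monomial_mul, add_comm]
    · rintro ⟨_, ⟨d, hd, rfl⟩, rfl⟩
      refine ⟨_, ⟨_, ⟨fun t => d t.succ, fun t => hd _, rfl⟩, rfl⟩, _, ⟨d 0, hd 0, rfl⟩, ?_⟩
      simp [monomial_mul, Fin.sum_univ_succ, add_comm]

lemma isMonomialIdeal_coverIdeal_pow [Finite V] (G : SimpleGraph V) (k : Type v) [Field k]
    (s : ℕ) : IsMonomialIdeal (G.coverIdeal k ^ s) {m : V →₀ ℕ | G.HasColorSets s m} := by
  classical
  intro f
  rw [coverIdeal_pow_eq_span, mem_ideal_span_monomial_image]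
  refine forall₂_congr fun m _ => ⟨?_, ?_⟩
  · rintro ⟨_, ⟨d, hd, rfl⟩, hle⟩
    refine ⟨fun i => Finset.univ.filter fun t => d t i = 0, fun i j hij => ?_, fun i => ?_⟩
    · rw [Finset.disjoint_left]
      intro t hi hj
      have := hd t i j hij
      simp_all
    · have h1 := hle i
      rw [Finsupp.finsetSum_apply] at h1
      have h2 : ∑ t : Fin s, 1 ≤ ∑ t, (d t i + if d t i = 0 then 1 else 0) :=
        Finset.sum_le_sum fun t _ => by split_ifs <;> omega
      rw [Finset.sum_add_distrib, ← Finset.card_filter] at h2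
      simp only [Finset.sum_const, Finset.card_univ, Fintype.card_fin, smul_eq_mul, mul_one] at h2
      simp only
      omega
  · rintro ⟨c, hc, hs⟩
    refine ⟨_, ⟨fun t => Finsupp.equivFunOnFinite.symm fun i => if t ∈ c i then 0 else 1,
      fun t i j hij => ?_, rfl⟩, fun i => ?_⟩
    · have : t ∈ c i → t ∉ c j := fun h => Finset.disjoint_left.1 (hc i j hij) h
      by_cases hi : t ∈ c i <;> simp_all
    · rw [Finsupp.finsetSum_apply]
      have h1 := hs i
      have h2 : ∑ t : Fin s, ((if t ∈ c i then 0 else 1) + if t ∈ c i then 1 else 0) = s := by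
        rw [Finset.sum_congr rfl (g := fun _ => 1) fun t _ => by split_ifs <;> rfl]
        simp
      rw [Finset.sum_add_distrib] at h2
      have h3 : ∑ t : Fin s, (if t ∈ c i then 1 else 0) = (c i).card := by simp
      simp only [Finsupp.equivFunOnFinite_symm_apply_apply]
      omega

/-- The associated primes of the square of the cover ideal come from edges and induced odd
cycles. -/
lemma eq_pair_or_isOddCycle_of_hasColorSets_two {G : SimpleGraph V} [Finite V] {S : Set V}
    {a : V →₀ ℕ} (h₁ : ∀ i ∈ S, G.HasColorSets 2 (Finsupp.single i 1 + a : V →₀ ℕ))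
    (h₂ : ∀ m : V →₀ ℕ, (∀ i ∈ S, m i = 0) → ¬ G.HasColorSets 2 (m + a : V →₀ ℕ)) :
    (∃ i j, G.Adj i j ∧ S = {i, j}) ∨ (G.induce S).IsOddCycle := by
  classical
  -- Raising exponents outside `S` is allowed by `h₂` and removes all demands there.
  set d : V →₀ ℕ := Finsupp.equivFunOnFinite.symm fun i => if i ∈ S then 0 else 2 with hd
  set b : V →₀ ℕ := d + a with hb
  have hbS : ∀ i, i ∉ S → 2 ≤ b i := fun i hi => by simp [hb, hd, hi]
  have hnot : ¬ G.HasColorSets 2 b := h₂ d fun i hi => by simp [hd, hi]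
  have hadd : ∀ l ∈ S, (∀ i j, G.Adj i j →
      2 ≤ (b i + if i = l then 1 else 0) + (b j + if j = l then 1 else 0)) ∧
      (G.induce {i | (b i + if i = l then 1 else 0) = 1}).Colorable 2 := fun l hl => by
    refine hasColorSets_two_iff.1 ((h₁ l hl).mono fun i => ?_)
    simp only [hb, Finsupp.add_apply, Finsupp.single_apply, eq_comm (a := l)]
    omega
  rw [hasColorSets_two_iff, not_and_or] at hnot
  rcases hnot with hnot | hnot
  · left
    push Not at hnot
    obtain ⟨i, j, hij, hlt⟩ := hnot
    refine ⟨i, j, hij, Set.Subset.antisymm (fun l hl => ?_) ?_⟩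
    · have := (hadd l hl).1 i j hij
      by_contra hne
      simp only [Set.mem_insert_iff, Set.mem_singleton_iff, not_or] at hne
      rw [if_neg (Ne.symm hne.1), if_neg (Ne.symm hne.2)] at this
      omega
    · rintro l (rfl | rfl) <;> by_contra hl <;> have := hbS _ hl <;> omega
  · right
    have hSb : S = {i | b i = 1} := by
      refine Set.Subset.antisymm (fun l hl => ?_) fun i (hi : b i = 1) => ?_
      -- If `b l ≠ 1`, raising `b` at `l` loses no vertex of `{b = 1}`, which would then be
      -- 2-colourable.
      · by_contra hbl
        refine hnot ((hadd l hl).2.of_hom (G.induceHomOfLE fun i (hi : b i = 1) => ?_).toHom)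
        have hil : i ≠ l := fun h => hbl (h ▸ hi)
        simpa [hil] using hi
      · by_contra hiS
        have := hbS i hiS
        omega
    rw [← hSb] at hnot
    refine (isCriticallyChromatic_three_iff _).1 ((isCriticallyChromatic_succ_iff _ 2).2
      ⟨hnot, fun x => ?_⟩)
    obtain ⟨f, hf⟩ := (colorable_induce_iff _ _ 1).1 (hadd x x.2).2
    refine (colorable_induce_iff _ _ 1).2 ⟨fun i => f i, fun i hi j hj hij => ?_⟩
    have hmem : ∀ i : S, i ∈ ({x}ᶜ : Set S) → b i + (if (i : V) = x then 1 else 0) = 1 := by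
      intro i hi
      have hbi : (i : V) ∈ {i | b i = 1} := hSb ▸ i.2
      have hne : (i : V) ≠ x := fun h => hi (Subtype.ext h)
      simpa [hne] using hbi
    exact hf i (hmem i hi) j (hmem j hj) (by simpa using hij)

variable [Finite V] (G : SimpleGraph V) (k : Type v) [Field k]

lemma span_pair_mem_associatedPrimes_coverIdeal_pow_three {i j : V} (hij : G.Adj i j) :
    Ideal.span {X i, X j} ∈
      associatedPrimes (MvPolynomial V k) (MvPolynomial V k ⧸ G.coverIdeal k ^ 3) := by
  classical
  rw [← Set.image_pair (fun i : V => (X i : MvPolynomial V k))]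
  have hne := hij.ne
  refine (G.isMonomialIdeal_coverIdeal_pow k 3).span_X_image_mem_associatedPrimes
    -- The sum `2 + 0` on the edge is one short of the required 3; exponent 3 demands nothing.
    (a := Finsupp.equivFunOnFinite.symm fun l => if l = i then 2 else if l = j then 0 else 3) ?_ ?_
  · rintro l (rfl | rfl)
    · refine ⟨fun t => if t = j then Finset.univ else ∅, fun t t' ht => ?_, fun t => ?_⟩
      · have := ht.ne
        simp only
        split_ifs <;> simp_all
      · by_cases h1 : t = l <;> by_cases h2 : t = j <;> simp_all
    · refine ⟨fun t => if t = l then {0, 1} else if t = i then {2} else ∅,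
        fun t t' ht => ?_, fun t => ?_⟩
      · have := ht.ne
        simp only
        split_ifs <;> simp_all
      · by_cases h1 : t = l <;> by_cases h2 : t = i <;> simp_all
  · intro m hm hcol
    have := hcol.le_add_of_adj hij
    simp [hm i (by simp), hm j (by simp), hne.symm] at this

lemma span_image_mem_associatedPrimes_coverIdeal_pow_three {S : Set V}
    (hS : (G.induce S).IsOddCycle) :
    Ideal.span ((fun i : V => (X i : MvPolynomial V k)) '' S) ∈
      associatedPrimes (MvPolynomial V k) (MvPolynomial V k ⧸ G.coverIdeal k ^ 3) := by
  classical
  obtain ⟨r, hr, ⟨e⟩⟩ := hS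
  -- The demands `3 - a` are two colours at odd positions, one at even positions, none off `S`.
  set a : V →₀ ℕ := Finsupp.equivFunOnFinite.symm fun l =>
    if h : l ∈ S then (if Odd (e ⟨l, h⟩ : ℕ) then 1 else 2) else 3 with ha
  refine (G.isMonomialIdeal_coverIdeal_pow k 3).span_X_image_mem_associatedPrimes (a := a) ?_ ?_
  · intro l hl
    obtain ⟨c, hc, hcard⟩ := exists_colorSets_cycleGraph hr (e ⟨l, hl⟩)
    refine ⟨fun i => if h : i ∈ S then c (e ⟨i, h⟩) else ∅, fun i j hij => ?_, fun i => ?_⟩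
    · by_cases hi : i ∈ S <;> by_cases hj : j ∈ S <;> simp only [hi, hj, dite_true, dite_false,
        Finset.disjoint_empty_left, Finset.disjoint_empty_right]
      exact hc _ _ (e.map_adj_iff.2 (by simpa using hij))
    · by_cases hi : i ∈ S
      · have := hcard (e ⟨i, hi⟩)
        simp only [EmbeddingLike.apply_eq_iff_eq, Subtype.mk.injEq] at this
        simp only [ha, hi, dite_true, Finsupp.add_apply, Finsupp.equivFunOnFinite_symm_apply_apply,
          Finsupp.single_apply, eq_comm (a := l)]
        split_ifs at this ⊢ <;> omega
      · simp [ha, hi]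
  · rintro m hm ⟨c, hc, hcard⟩
    refine not_exists_colorSets_cycleGraph hr (fun i => c (e.symm i)) (fun i j hij => ?_)
      (fun i hi => ?_) fun i => ?_
    · have := e.symm.map_adj_iff.2 hij
      exact hc _ _ (by simpa using this)
    · have := hcard (e.symm i)
      simp [ha, hm, hi] at this
      omega
    · have := hcard (e.symm i)
      refine Finset.card_pos.1 ?_
      simp [ha, hm] at this
      split_ifs at this <;> omega

lemma associatedPrimes_coverIdeal_sq_subset :
    associatedPrimes (MvPolynomial V k) (MvPolynomial V k ⧸ G.coverIdeal k ^ 2) ⊆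
      associatedPrimes (MvPolynomial V k) (MvPolynomial V k ⧸ G.coverIdeal k ^ 3) := by
  intro P hP
  obtain ⟨S, a, rfl, h₁, h₂⟩ :=
    (G.isMonomialIdeal_coverIdeal_pow k 2).exists_of_mem_associatedPrimes hP
  rcases eq_pair_or_isOddCycle_of_hasColorSets_two h₁ h₂ with ⟨i, j, hij, rfl⟩ | hS
  · rw [Set.image_pair]
    exact G.span_pair_mem_associatedPrimes_coverIdeal_pow_three k hij
  · exact G.span_image_mem_associatedPrimes_coverIdeal_pow_three k hS

end SimpleGraph

theorem mainTheorem5 {V : Type u} [Finite V] (G : SimpleGraph V) (k : Type v) [Field k] :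
    -- the critically 3-chromatic graphs are the odd cycles
    (G.IsCriticallyChromatic 3 ↔ G.IsOddCycle) ∧
    -- expanding an odd cycle `x₁, …, x_{2r+1}` at `{x₂, x₄, …, x_{2r}}` (here `x_{i+1}` is `i`)
    (∀ r : ℕ, 1 ≤ r →
      (SimpleGraph.cycleGraph (2 * r + 1)).chromaticNumber = 3 ∧
      ((SimpleGraph.cycleGraph (2 * r + 1)).expansion
        {i : Fin (2 * r + 1) | Odd (i : ℕ)}).chromaticNumber = 4 ∧
      ((SimpleGraph.cycleGraph (2 * r + 1)).expansion
        {i : Fin (2 * r + 1) | Odd (i : ℕ)}).IsCriticallyChromatic 4) ∧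
    -- the conjecture for `s = 3`
    (G.IsCriticallyChromatic 3 → ∃ W : Set V, (G.expansion W).IsCriticallyChromatic 4) ∧
    -- `Ass(R/J²) ⊆ Ass(R/J³)`
    associatedPrimes (MvPolynomial V k) (MvPolynomial V k ⧸ (G.coverIdeal k) ^ 2) ⊆
      associatedPrimes (MvPolynomial V k) (MvPolynomial V k ⧸ (G.coverIdeal k) ^ 3) ∧
    -- the primes of edges and of induced odd cycles belong to `Ass(R/J³)`
    (∀ i j : V, G.Adj i j →
      Ideal.span {MvPolynomial.X i, MvPolynomial.X j} ∈
        associatedPrimes (MvPolynomial V k) (MvPolynomial V k ⧸ (G.coverIdeal k) ^ 3)) ∧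
    (∀ S : Set V, (G.induce S).IsOddCycle →
      Ideal.span ((fun i : V => (MvPolynomial.X i : MvPolynomial V k)) '' S) ∈
        associatedPrimes (MvPolynomial V k) (MvPolynomial V k ⧸ (G.coverIdeal k) ^ 3)) := by
  refine ⟨G.isCriticallyChromatic_three_iff, fun r hr => ?_, fun h => ?_,
    G.associatedPrimes_coverIdeal_sq_subset k,
    fun i j hij => G.span_pair_mem_associatedPrimes_coverIdeal_pow_three k hij,
    fun S hS => G.span_image_mem_associatedPrimes_coverIdeal_pow_three k hS⟩
  · have h := SimpleGraph.isCriticallyChromatic_expansion_cycleGraph hr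
    exact ⟨(SimpleGraph.isCriticallyChromatic_cycleGraph hr).1, h.1, h⟩
  · exact h.isOddCycle.exists_isCriticallyChromatic_expansion
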